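/- Let $I=[0,1]$, let $d_I$ be a metric on $I$ inducing the usual topology, let $\theta,\eta\in(0,1)$ and $\beta>0$, and equip $\Omega=I^{\mathbb Z}$ with the metric $d(x,y)=\sup_{k\in\mathbb Z}\theta^{|k|}d_I(x_k,y_k)$. Let $\tau:I\to I$ have $b$ full branches: there are $0=a_0<a_1<\dots<a_b=1$ and homeomorphisms $\zeta_j:[0,1]\to[a_{j-1},a_j]$ $(1\le j\le b)$, the inverse branches of $\tau$, such that $\tau(\zeta_j(x))=x$ for all $j$ and all $x\in(0,1)$, and every $y\in I$ satisfies $y=\zeta_j(\tau(y))$ for some $j$. Let $\tau$ be expanding, i.e. $d_I(\zeta_j(x),\zeta_j(y))\le\eta\, d_I(x,y)$ for all $j$ and all $x,y\in I$, and let $p$ be a fixed point of $\tau$. For $k\in\mathbb N$ let $\Lambda_k=\{-k,\dots,k\}$, and let $\pi_k:\Omega\to\Omega$ replace all coordinates outside $\Lambda_k$ by $p$. For $\Phi\in C(\Omega)$ put $|\Phi|_\beta=\sup_{k}\sup_{x\ne y}|\Phi(\pi_kx)-\Phi(\pi_ky)|/d(x,y)^\beta$, and let $\mathcal C=\{\Phi\in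 C(\Omega):|\Phi|_\infty+|\Phi|_\beta<\infty\}$. Fix $f\in\mathcal C$. For $w\in\{1,\dots,b\}^{\Lambda_k}$ let $\zeta_w(x)\in\Omega$ have coordinates $\zeta_{w_i}(x_i)$ for $|i|\le k$ and $x_i$ for $|i|>k$. For $\Phi\in C(\Omega)$ define $$P_k\Phi(x)=\frac1{b^{2k+1}}\sum_{w}e^{f(\pi_k\zeta_w(x))}\,\Phi(\pi_k\zeta_w(x)),\qquad P\Phi(x)=\lim_{k\to\infty}P_k\Phi(x).$$ For a Borel probability measure $\nu$ on $\Omega$ put $P^*\nu(\Phi)=\int P\Phi\,d\nu$. Let $B(z)=\exp\big(|f|_\beta\frac{\eta^\beta}{1-\eta^\beta}z^\beta\big)$ for $z\ge0$, and $$\Delta_f=\Delta_f(\nu)=\Big\{\Phi\in C(\Omega):\ \Phi\ge0,\ \int\Phi\,d\nu=1,\ \Phi(x)\le B(d(x,y))\,\Phi(y)\ \text{ for all }x,y\in\Omega\Big\}.$$ Then the limit defining $P\Phi(x)$ exists for all $\Phi\in C(\Omega)$ and $x\in\Omega$, and there is a Borel probability measure $\nu$ on $\Omega$ with $P^*\nu=\lambda\nu$,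 where $\lambda=P^*\nu(1)$. Moreover, for every such $\nu$ (with its $\lambda$) there is a unique $h\in\Delta_f$ with $Ph=\lambda h$, and this $h$ is strictly positive on $\Omega$. -/

import Mathlib

open Filter Topology MeasureTheory

noncomputable section

namespace LatticeMap

/-- The lattice space `Ω = I ^ ℤ`, with `I = [0, 1]`. It carries the product topology, which is the
topology of the metric `latticeDist` below, and the corresponding Borel `σ`-algebra. -/
abbrev Lattice : Type := ℤ → unitInterval

/-- `dI` is a metric on the unit interval inducing its usual topology. -/
structure IsIntervalMetric (dI : unitInterval → unitInterval → ℝ) : Prop where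
  self : ∀ x, dI x x = 0
  eq_of_zero : ∀ x y, dI x y = 0 → x = y
  symm : ∀ x y, dI x y = dI y x
  triangle : ∀ x y z, dI x z ≤ dI x y + dI y z
  isOpen_iff : ∀ s : Set unitInterval,
    IsOpen s ↔ ∀ x ∈ s, ∃ ε > 0, ∀ y, dI x y < ε → y ∈ s

/-- The metric `d(x, y) = sup_k θ ^ |k| d_I(x_k, y_k)` on `Ω`. -/
def latticeDist (dI : unitInterval → unitInterval → ℝ) (θ : ℝ) (x y : Lattice) : ℝ :=
  ⨆ k : ℤ, θ ^ k.natAbs * dI (x k) (y k)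

/-- `τ` has `b` full branches, with inverse branches `ζ 0, …, ζ (b - 1)`: for a subdivision
`0 = a 0 < ⋯ < a b = 1`, the map `ζ j` is a homeomorphism of `[0, 1]` onto `[a j, a (j + 1)]`, and
`τ` is inverse to it. At the finitely many subdivision points, where two closed branches meet, `τ`
takes the value of one of the two, so `τ ∘ ζ j = id` is only asked on the open interval. -/
structure HasFullBranches (τ : unitInterval → unitInterval) {b : ℕ}
    (ζ : Fin b → unitInterval → unitInterval) : Prop where
  continuous : ∀ j, Continuous (ζ j)
  injective : ∀ j, Function.Injective (ζ j)
  subdivision : ∃ a : Fin (b + 1) → unitInterval, StrictMono a ∧ a 0 = 0 ∧ a (Fin.last b) = 1 ∧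
    ∀ j : Fin b, Set.range (ζ j) = Set.Icc (a j.castSucc) (a j.succ)
  rightInverse : ∀ j, ∀ x ∈ Set.Ioo (0 : unitInterval) 1, τ (ζ j x) = x
  branch_of : ∀ y, ∃ j, ζ j (τ y) = y

/-- `τ` is expanding: its inverse branches contract `dI` by the factor `η`. -/
def IsExpanding (dI : unitInterval → unitInterval → ℝ) (η : ℝ) {b : ℕ}
    (ζ : Fin b → unitInterval → unitInterval) : Prop :=
  ∀ j x y, dI (ζ j x) (ζ j y) ≤ η * dI x y

/-- The finite sub-lattice `Λ_k = {-k, …, k}`. -/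
abbrev box (k : ℕ) : Finset ℤ := Finset.Icc (-(k : ℤ)) k

/-- The projection `π_k`, which replaces the coordinates outside `Λ_k` by `p`. -/
def proj (p : unitInterval) (k : ℕ) (x : Lattice) : Lattice :=
  fun i => if i ∈ box k then x i else p

/-- The Hölder constant `|Φ|_β = sup_k sup_{x, y} |Φ(π_k x) - Φ(π_k y)| / d(x, y) ^ β`,
possibly infinite. -/
def holderConst (dI : unitInterval → unitInterval → ℝ) (θ β : ℝ) (p : unitInterval)
    (Φ : C(Lattice, ℝ)) : ENNReal :=
  ⨆ (k : ℕ) (x : Lattice) (y : Lattice),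
    ENNReal.ofReal (|Φ (proj p k x) - Φ (proj p k y)| / latticeDist dI θ x y ^ β)

/-- The space `𝒞` of continuous functions `Φ` with `|Φ|_∞ + |Φ|_β < ∞`. -/
def holderSpace (dI : unitInterval → unitInterval → ℝ) (θ β : ℝ) (p : unitInterval) :
    Set C(Lattice, ℝ) :=
  {Φ | ENNReal.ofReal ‖Φ‖ + holderConst dI θ β p Φ < ⊤}

/-- The inverse branch of the product map on `Λ_k` in which site `i` uses the branch `ζ (w i)`;
coordinates outside `Λ_k` are unchanged. -/
def inverseBranch {b : ℕ} (ζ : Fin b → unitInterval → unitInterval) (k : ℕ)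
    (w : box k → Fin b) (x : Lattice) : Lattice :=
  fun i => if hi : i ∈ box k then ζ (w ⟨i, hi⟩) (x i) else x i

/-- The transfer operator `P_k` of the finite sub-lattice `Λ_k`, with potential `f`. -/
def transferApprox {b : ℕ} (ζ : Fin b → unitInterval → unitInterval) (p : unitInterval)
    (f : C(Lattice, ℝ)) (k : ℕ) (Φ : C(Lattice, ℝ)) (x : Lattice) : ℝ :=
  1 / (b : ℝ) ^ (2 * k + 1) * ∑ w : box k → Fin b,
    Real.exp (f (proj p k (inverseBranch ζ k w x))) * Φ (proj p k (inverseBranch ζ k w x))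

/-- The transfer operator `P`, the pointwise limit of the `P_k`. -/
def transfer {b : ℕ} (ζ : Fin b → unitInterval → unitInterval) (p : unitInterval)
    (f : C(Lattice, ℝ)) (Φ : C(Lattice, ℝ)) (x : Lattice) : ℝ :=
  limUnder atTop fun k => transferApprox ζ p f k Φ x

/-- `(P^* ν)(Φ) = ν(P Φ)`. -/
def dualTransfer {b : ℕ} (ζ : Fin b → unitInterval → unitInterval) (p : unitInterval)
    (f : C(Lattice, ℝ)) (ν : ProbabilityMeasure Lattice) (Φ : C(Lattice, ℝ)) : ℝ :=
  ∫ x, transfer ζ p f Φ x ∂(ν : Measure Lattice)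

/-- `ν` is an eigenmeasure: `P^* ν = lam ν` with `lam = (P^* ν)(1)`, i.e. `ν` is a fixed point of
`ν ↦ P^* ν / (P^* ν)(1)`. -/
def IsEigenmeasure {b : ℕ} (ζ : Fin b → unitInterval → unitInterval) (p : unitInterval)
    (f : C(Lattice, ℝ)) (ν : ProbabilityMeasure Lattice) (lam : ℝ) : Prop :=
  lam = dualTransfer ζ p f ν 1 ∧
    ∀ Φ : C(Lattice, ℝ), dualTransfer ζ p f ν Φ = lam * ∫ x, Φ x ∂(ν : Measure Lattice)

/-- `B(z) = exp (|f|_β η ^ β / (1 - η ^ β) z ^ β)`. -/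
def distortion (dI : unitInterval → unitInterval → ℝ) (θ β η : ℝ) (p : unitInterval)
    (f : C(Lattice, ℝ)) (z : ℝ) : ℝ :=
  Real.exp ((holderConst dI θ β p f).toReal * (η ^ β / (1 - η ^ β)) * z ^ β)

/-- The set `Δ_f` of `Φ ∈ C(Ω)` with `Φ ≥ 0`, `ν(Φ) = 1` and `Φ(x) ≤ B(d(x, y)) Φ(y)`. -/
def densitySet (dI : unitInterval → unitInterval → ℝ) (θ β η : ℝ) (p : unitInterval)
    (f : C(Lattice, ℝ)) (ν : ProbabilityMeasure Lattice) : Set C(Lattice, ℝ) :=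
  {Φ | (∀ x, 0 ≤ Φ x) ∧ ∫ x, Φ x ∂(ν : Measure Lattice) = 1 ∧
    ∀ x y, Φ x ≤ distortion dI θ β η p f (latticeDist dI θ x y) * Φ y}

end LatticeMap

end

/-! Choose a branch at every site independently and uniformly. Since `π_k` erases what happens
outside `Λ_k`, `P_k Φ(x)` is an expectation over these choices, and dominated convergence identifies
`P Φ(x)` with the mean of `e^f Φ` over the random preimages of `x` (`tendsto_transferApprox`). So
`P` is a bounded positive operator on `C(Ω)`.

The function `B` is made so that `P` preserves the cone `Φ(x) ≤ B(d(x, y)) Φ(y)`: branches contract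
`d` by `η`, and the constant `c` in the exponent of `B` solves `(|f|_β + c) η^β = c`
(`exp_mul_distortion_le`). As `d` is bounded, the iterates `P^n 1` have distortion bounded uniformly
in `n`. Hence they grow like `r^n` up to a constant, and generalised limits of averages of `r^{-n}
P^n Φ(x₀)` give a positive functional `L` with `L ∘ P = r L`, that is, an eigenmeasure
(`exists_positive_eigenfunctional`).

Given `ν`, the normalised cone is compact by Arzelà–Ascoli, and a limit point of the averages of
`λ^{-n} P^n 1` is the eigenfunction `h` (`exists_eigenfunction`). For a second one `h'`, let `t =
min h'/h`: then `h' - t h` is a nonnegative eigenfunction with a zero. Zeros propagate to all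
preimages, which are dense (`dense_of_invariant`), so `h' = t h`, and normalisation gives `t = 1`.
-/

namespace LatticeMap

/-! ### Growth rates and eigenfunctionals of positive operators -/

/-- A sequence that is both sub- and supermultiplicative up to a constant grows like a power. -/
theorem exists_growth_rate (a : ℕ → ℝ) {C c M : ℝ} (hc : 0 < c) (hC : 1 ≤ C)
    (hlow : ∀ n, c ^ n ≤ a n) (hupp : ∀ n, a n ≤ M ^ n)
    (hsub : ∀ m n, a (m + n) ≤ C * (a m * a n)) (hsup : ∀ m n, a m * a n ≤ C * a (m + n)) :
    ∃ r : ℝ, 0 < r ∧ ∀ n, r ^ n ≤ C * a n ∧ a n ≤ C * r ^ n := by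
  have hC0 : 0 < C := by linarith
  have ha : ∀ n, 0 < a n := fun n => (pow_pos hc n).trans_le (hlow n)
  have hlogC : 0 ≤ Real.log C := Real.log_nonneg hC
  -- Fekete's lemma is applied to `log C + log a` and to `log C - log a`. A Fekete limit bounds its
  -- sequence from below, so the two together bound `log a n` from both sides.
  have hv : Subadditive fun n => Real.log C + Real.log (a n) := by
    intro m n
    have h := Real.log_le_log (ha _) (hsub m n)
    rw [Real.log_mul hC0.ne' (mul_pos (ha m) (ha n)).ne', Real.log_mul (ha m).ne' (ha n).ne'] at h
    linarith
  have hw : Subadditive fun n => Real.log C - Real.log (a n) := by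
    intro m n
    have h := Real.log_le_log (mul_pos (ha m) (ha n)) (hsup m n)
    rw [Real.log_mul hC0.ne' (ha _).ne', Real.log_mul (ha m).ne' (ha n).ne'] at h
    linarith
  have hv' : BddBelow (Set.range fun n : ℕ => (Real.log C + Real.log (a n)) / n) := by
    -- The `0` covers the term `n = 0`, where division by zero gives `0`.
    refine ⟨min 0 (Real.log c), ?_⟩
    rintro _ ⟨n, rfl⟩
    rcases Nat.eq_zero_or_pos n with rfl | hn
    · simp
    · refine (min_le_right _ _).trans ?_
      have hn' : (0 : ℝ) < n := Nat.cast_pos.2 hn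
      have h := Real.log_le_log (pow_pos hc n) (hlow n)
      rw [Real.log_pow] at h
      simp only
      rw [le_div_iff₀ hn']
      nlinarith
  have hw' : BddBelow (Set.range fun n : ℕ => (Real.log C - Real.log (a n)) / n) := by
    refine ⟨min 0 (-Real.log M), ?_⟩
    rintro _ ⟨n, rfl⟩
    rcases Nat.eq_zero_or_pos n with rfl | hn
    · simp
    · refine (min_le_right _ _).trans ?_
      have hn' : (0 : ℝ) < n := Nat.cast_pos.2 hn
      have h := Real.log_le_log (ha n) (hupp n)
      rw [Real.log_pow] at h
      simp only
      rw [le_div_iff₀ hn']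
      nlinarith
  -- The two sequences add up to `2 log C / n`, so the limits are opposite and define one rate.
  have hlim : hv.lim + hw.lim = 0 := by
    refine tendsto_nhds_unique ((hv.tendsto_lim hv').add (hw.tendsto_lim hw')) ?_
    have := tendsto_const_div_atTop_nhds_zero_nat (2 * Real.log C)
    refine this.congr fun n => ?_
    rw [← add_div]
    congr 1
    ring
  refine ⟨Real.exp hv.lim, Real.exp_pos _, fun n => ?_⟩
  rcases Nat.eq_zero_or_pos n with rfl | hn
  · have h1 := hlow 0
    have h2 := hupp 0
    simp only [pow_zero] at *
    exact ⟨by nlinarith, by linarith⟩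
  have hn' : (0 : ℝ) < n := Nat.cast_pos.2 hn
  have h1 := hv.lim_le_div hv' hn.ne'
  have h2 := hw.lim_le_div hw' hn.ne'
  rw [le_div_iff₀ hn'] at h1 h2
  rw [← Real.exp_nat_mul]
  constructor
  · rw [← Real.exp_log (mul_pos hC0 (ha n)), Real.log_mul hC0.ne' (ha n).ne', Real.exp_le_exp]
    linarith
  · calc a n = Real.exp (Real.log (a n)) := (Real.exp_log (ha n)).symm
      _ ≤ Real.exp (Real.log C + n * hv.lim) := Real.exp_le_exp.2 (by nlinarith)
      _ = C * Real.exp (n * hv.lim) := by rw [Real.exp_add, Real.exp_log hC0]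

section PositiveOperator

variable {X : Type*} [TopologicalSpace X]

theorem apply_le_apply_of_positive {P : C(X, ℝ) →L[ℝ] C(X, ℝ)}
    (hP : ∀ Φ : C(X, ℝ), (∀ x, 0 ≤ Φ x) → ∀ x, 0 ≤ P Φ x) {Φ Ψ : C(X, ℝ)}
    (h : ∀ x, Φ x ≤ Ψ x) (x : X) : P Φ x ≤ P Ψ x := by
  have := hP (Ψ - Φ) (fun y => by simpa using h y) x
  simpa using this

theorem pow_positive {P : C(X, ℝ) →L[ℝ] C(X, ℝ)}
    (hP : ∀ Φ : C(X, ℝ), (∀ x, 0 ≤ Φ x) → ∀ x, 0 ≤ P Φ x) (n : ℕ) :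
    ∀ Φ : C(X, ℝ), (∀ x, 0 ≤ Φ x) → ∀ x, 0 ≤ (P ^ n) Φ x := by
  induction n with
  | zero => intro Φ h; simpa using h
  | succ n ih =>
    intro Φ h x
    rw [pow_succ]
    exact ih _ (hP Φ h) x

theorem apply_const_mul_one (P : C(X, ℝ) →L[ℝ] C(X, ℝ)) (c : ℝ) (x : X) :
    P (c • (1 : C(X, ℝ))) x = c * P 1 x := by simp

variable [CompactSpace X]

/-- Positivity applied to `-‖Φ‖ ≤ Φ ≤ ‖Φ‖`: bounds on the iterates of `1` control the iterates of
every function. -/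
theorem abs_apply_le_norm_mul {P : C(X, ℝ) →L[ℝ] C(X, ℝ)}
    (hP : ∀ Φ : C(X, ℝ), (∀ x, 0 ≤ Φ x) → ∀ x, 0 ≤ P Φ x) (Φ : C(X, ℝ)) (x : X) :
    |P Φ x| ≤ ‖Φ‖ * P 1 x := by
  have h : ∀ y, |Φ y| ≤ ‖Φ‖ := fun y => Φ.norm_coe_le_norm y
  rw [abs_le]
  constructor
  · have := apply_le_apply_of_positive hP (Φ := (-‖Φ‖) • (1 : C(X, ℝ))) (Ψ := Φ)
      (fun y => by simpa using (abs_le.1 (h y)).1) x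
    rw [apply_const_mul_one] at this
    linarith
  · have := apply_le_apply_of_positive hP (Φ := Φ) (Ψ := ‖Φ‖ • (1 : C(X, ℝ)))
      (fun y => by simpa using (abs_le.1 (h y)).2) x
    rwa [apply_const_mul_one] at this

/-- A positive operator whose iterates of `1` have bounded distortion has the growth rate of these
iterates as an eigenvalue of its dual, with a positive eigenfunctional. -/
theorem exists_positive_eigenfunctional {P : C(X, ℝ) →L[ℝ] C(X, ℝ)}
    (hP : ∀ Φ : C(X, ℝ), (∀ x, 0 ≤ Φ x) → ∀ x, 0 ≤ P Φ x) {c C : ℝ} (hc : 0 < c) (hC : 1 ≤ C)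
    (hone : ∀ x, c ≤ P 1 x) (hdist : ∀ n x y, (P ^ n) 1 x ≤ C * (P ^ n) 1 y) (x₀ : X) :
    ∃ (r : ℝ) (L : C(X, ℝ) →ₗ[ℝ] ℝ), (∀ Φ : C(X, ℝ), (∀ x, 0 ≤ Φ x) → 0 ≤ L Φ) ∧ L 1 = 1 ∧
      ∀ Φ, L (P Φ) = r * L Φ := by
  have hC0 : 0 < C := by linarith
  set a : ℕ → ℝ := fun n => (P ^ n) 1 x₀ with ha_def
  have hlow : ∀ n x, c ^ n ≤ (P ^ n) 1 x := by
    intro n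
    induction n with
    | zero => intro x; simp
    | succ n ih =>
      intro x
      have := apply_le_apply_of_positive hP (Φ := c ^ n • (1 : C(X, ℝ))) (Ψ := (P ^ n) 1)
        (fun y => by simpa using ih y) x
      rw [apply_const_mul_one] at this
      rw [pow_succ, pow_succ']
      exact (mul_le_mul_of_nonneg_left (hone x) (pow_pos hc n).le).trans this
  have hM : 0 < ‖P 1‖ := (hc.trans_le (hone x₀)).trans_le
    ((le_abs_self _).trans ((P 1).norm_coe_le_norm x₀))
  have hupp : ∀ n x, (P ^ n) 1 x ≤ ‖P 1‖ ^ n := by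
    intro n
    induction n with
    | zero => intro x; simp
    | succ n ih =>
      intro x
      have := apply_le_apply_of_positive hP (Φ := (P ^ n) 1) (Ψ := ‖P 1‖ ^ n • (1 : C(X, ℝ)))
        (fun y => by simpa using ih y) x
      rw [apply_const_mul_one] at this
      rw [pow_succ' P n, pow_succ _ n]
      exact this.trans (mul_le_mul_of_nonneg_left
        ((le_abs_self _).trans ((P 1).norm_coe_le_norm x)) (pow_pos hM n).le)
  have ha : ∀ n, 0 < a n := fun n => (pow_pos hc n).trans_le (hlow n x₀)
  -- Bounded distortion compares `P^n 1` with the constant `a n` up to the factor `C`; applying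
  -- `P^m` and evaluating at `x₀` gives both almost-multiplicativity bounds.
  obtain ⟨r, hr, hra⟩ := exists_growth_rate a hc hC (fun n => hlow n x₀) (fun n => hupp n x₀)
    (by
      intro m n
      have := apply_le_apply_of_positive (pow_positive hP m) (Φ := (P ^ n) 1)
        (Ψ := (C * a n) • (1 : C(X, ℝ))) (fun y => by
          simpa only [ContinuousMap.smul_apply, ContinuousMap.one_apply, smul_eq_mul, mul_one] using hdist n y x₀) x₀
      rw [apply_const_mul_one] at this
      simp only [ha_def, pow_add] at *
      calc _ ≤ _ := this
        _ = _ := by ring)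
    (by
      intro m n
      have := apply_le_apply_of_positive (pow_positive hP m) (Φ := (a n) • (1 : C(X, ℝ)))
        (Ψ := C • (P ^ n) 1) (fun y => by
          simpa only [ContinuousMap.smul_apply, ContinuousMap.one_apply, smul_eq_mul, mul_one] using hdist n x₀ y) x₀
      rw [apply_const_mul_one] at this
      simp only [ha_def, pow_add, map_smul] at *
      calc _ = _ := mul_comm _ _
        _ ≤ _ := this)
  -- `F N` is a weighted average along the orbit, divided by `Z N` so that `F N 1 = 1` for `N > 0`.
  -- Each term of `Z N` is at least `1 / C`, so `Z` grows linearly.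
  set Z : ℕ → ℝ := fun N => ∑ n ∈ Finset.range N, (r ^ n)⁻¹ * a n with hZ
  set F : ℕ → C(X, ℝ) → ℝ := fun N Φ =>
    (∑ n ∈ Finset.range N, (r ^ n)⁻¹ * (P ^ n) Φ x₀) / Z N with hF
  have hrn : ∀ n, 0 < (r ^ n)⁻¹ := fun n => inv_pos.2 (pow_pos hr n)
  have hZlow : ∀ N : ℕ, N / C ≤ Z N := by
    intro N
    have : ∀ n ∈ Finset.range N, 1 / C ≤ (r ^ n)⁻¹ * a n := by
      intro n _
      rw [div_le_iff₀ hC0, mul_assoc, ← div_eq_inv_mul, one_le_div (pow_pos hr n), mul_comm]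
      exact (hra n).1
    have h := Finset.sum_le_sum this
    simpa [div_eq_mul_inv] using h
  have hZ0 : ∀ N, 0 ≤ Z N := fun N => le_trans (by positivity) (hZlow N)
  have hFbound : ∀ N Φ, F N Φ ∈ Set.Icc (-‖Φ‖) ‖Φ‖ := by
    intro N Φ
    refine Set.mem_Icc.2 (abs_le.1 ?_)
    simp only [hF]
    rw [abs_div, abs_of_nonneg (hZ0 N)]
    refine div_le_of_le_mul₀ (hZ0 N) (norm_nonneg _) ?_
    rw [hZ, Finset.mul_sum]
    refine (Finset.abs_sum_le_sum_abs _ _).trans (Finset.sum_le_sum fun n _ => ?_)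
    rw [abs_mul, abs_of_pos (hrn n), mul_left_comm]
    exact mul_le_mul_of_nonneg_left (abs_apply_le_norm_mul (pow_positive hP n) Φ x₀) (hrn n).le
  -- An ultrafilter picks limits for all `Φ` at once, which keeps the limit linear in `Φ`.
  let U : Ultrafilter ℕ := Ultrafilter.of atTop
  have hU : (U : Filter ℕ) ≤ atTop := Ultrafilter.of_le _
  have hlim : ∀ Φ, ∃ l, Tendsto (fun N => F N Φ) U (𝓝 l) := by
    intro Φ
    obtain ⟨l, _, hl⟩ := (isCompact_Icc (a := -‖Φ‖) (b := ‖Φ‖)).ultrafilter_le_nhds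
      (U.map fun N => F N Φ) (le_principal_iff.2
        (Filter.mem_map.2 (Filter.univ_mem' fun N => hFbound N Φ)))
    exact ⟨l, hl⟩
  choose L hL using hlim
  have hadd : ∀ Φ Ψ, L (Φ + Ψ) = L Φ + L Ψ := fun Φ Ψ =>
    tendsto_nhds_unique (hL _) (((hL Φ).add (hL Ψ)).congr fun N => by
      simp only [hF, map_add, ContinuousMap.add_apply, mul_add, Finset.sum_add_distrib, add_div])
  have hsmul : ∀ (t : ℝ) Φ, L (t • Φ) = t * L Φ := fun t Φ =>
    tendsto_nhds_unique (hL _) (((hL Φ).const_mul t).congr fun N => by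
      simp only [hF, map_smul, ContinuousMap.smul_apply, smul_eq_mul, ← mul_div_assoc,
        Finset.mul_sum, mul_left_comm])
  refine ⟨r, ⟨⟨L, hadd⟩, hsmul⟩, fun Φ hΦ => ?_, ?_, fun Φ => ?_⟩
  · exact ge_of_tendsto' (hL Φ) fun N => div_nonneg (Finset.sum_nonneg fun n _ =>
      mul_nonneg (hrn n).le (pow_positive hP n Φ hΦ x₀)) (hZ0 N)
  · refine tendsto_nhds_unique (hL 1) (tendsto_const_nhds.congr' ?_)
    filter_upwards [hU (eventually_gt_atTop 0)] with N hN
    have : 0 < Z N := lt_of_lt_of_le (by positivity) (hZlow N)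
    exact (div_self this.ne').symm
  · change L (P Φ) = r * L Φ
    rw [← sub_eq_zero]
    refine tendsto_nhds_unique ((hL (P Φ)).sub ((hL Φ).const_mul r)) (Tendsto.mono_left ?_ hU)
    -- The sums telescope to two boundary terms, bounded by a multiple of `‖Φ‖`, while the
    -- denominator is at least `N / C`.
    have hkey : ∀ N, F N (P Φ) - r * F N Φ =
        r * ((r ^ N)⁻¹ * (P ^ N) Φ x₀ - Φ x₀) / Z N := by
      intro N
      simp only [hF]
      rw [← mul_div_assoc, ← sub_div, Finset.mul_sum, ← Finset.sum_sub_distrib]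
      congr 1
      induction N with
      | zero => simp
      | succ N ih =>
        rw [Finset.sum_range_succ, ih]
        have : (P ^ N) (P Φ) = (P ^ (N + 1)) Φ := by rw [pow_succ]; rfl
        rw [this]
        field_simp
        ring
    refine squeeze_zero_norm' (a := fun N : ℕ => (r * ((C + 1) * ‖Φ‖) * C) / N) ?_
      (tendsto_const_div_atTop_nhds_zero_nat _)
    filter_upwards [eventually_gt_atTop 0] with N hN
    have hN' : (0 : ℝ) < N := Nat.cast_pos.2 hN
    rw [hkey, Real.norm_eq_abs, abs_div, abs_of_nonneg (hZ0 N), abs_mul, abs_of_pos hr]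
    have h1 : |(r ^ N)⁻¹ * (P ^ N) Φ x₀ - Φ x₀| ≤ (C + 1) * ‖Φ‖ := by
      have h2 : |(r ^ N)⁻¹ * (P ^ N) Φ x₀| ≤ C * ‖Φ‖ := by
        rw [abs_mul, abs_of_pos (hrn N), inv_mul_le_iff₀ (pow_pos hr N)]
        calc _ ≤ ‖Φ‖ * a N := abs_apply_le_norm_mul (pow_positive hP N) Φ x₀
          _ ≤ ‖Φ‖ * (C * r ^ N) := mul_le_mul_of_nonneg_left (hra N).2 (norm_nonneg _)
          _ = _ := by ring
      have h3 : |Φ x₀| ≤ ‖Φ‖ := Φ.norm_coe_le_norm x₀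
      exact (abs_sub _ _).trans (by linarith)
    calc _ ≤ (r * ((C + 1) * ‖Φ‖)) / (N / C) :=
          div_le_div₀ (by positivity) (mul_le_mul_of_nonneg_left h1 hr.le) (by positivity) (hZlow N)
      _ = _ := by field_simp

end PositiveOperator

/-! ### Positive functionals as measures -/

/-- A positive normalised functional on `C(X, ℝ)` is integration against a probability measure. -/
theorem exists_probabilityMeasure_of_positive {X : Type*} [TopologicalSpace X] [CompactSpace X]
    [T2Space X] [MeasurableSpace X] [BorelSpace X] (L : C(X, ℝ) →ₗ[ℝ] ℝ)
    (hL : ∀ Φ : C(X, ℝ), (∀ x, 0 ≤ Φ x) → 0 ≤ L Φ) (hL1 : L 1 = 1) :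
    ∃ ν : ProbabilityMeasure X, ∀ Φ : C(X, ℝ), ∫ x, Φ x ∂(ν : Measure X) = L Φ := by
  let Λ : CompactlySupportedContinuousMap X ℝ →ₗ[ℝ] ℝ :=
    { toFun := fun Φ => L (Φ : C(X, ℝ))
      map_add' := fun Φ Ψ => L.map_add _ _
      map_smul' := fun t Φ => L.map_smul t _ }
  let Λ' := PositiveLinearMap.mk₀ Λ fun Φ hΦ => hL _ (CompactlySupportedContinuousMap.le_def.1 hΦ)
  have hint : ∀ Φ : C(X, ℝ), ∫ x, Φ x ∂(RealRMK.rieszMeasure Λ') = L Φ := fun Φ =>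
    RealRMK.integral_rieszMeasure Λ' (CompactlySupportedContinuousMap.continuousMapEquiv Φ)
  have hfin : IsFiniteMeasure (RealRMK.rieszMeasure Λ') := by
    unfold RealRMK.rieszMeasure
    infer_instance
  have hprob : IsProbabilityMeasure (RealRMK.rieszMeasure Λ') := by
    have := hint 1
    simp only [ContinuousMap.one_apply, integral_const, smul_eq_mul, mul_one, hL1] at this
    exact ⟨by rwa [measureReal_def, ENNReal.toReal_eq_one_iff] at this⟩
  exact ⟨⟨_, hprob⟩, hint⟩

/-! ### Distortion cones and eigenfunctions -/

section Cone

variable {X : Type*}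

/-- The cone of nonnegative continuous functions whose oscillation is controlled by `V`. -/
def distortionCone [TopologicalSpace X] (V : X → X → ℝ) : Set C(X, ℝ) :=
  {Φ | (∀ x, 0 ≤ Φ x) ∧ ∀ x y, Φ x ≤ V x y * Φ y}

variable [TopologicalSpace X] {V : X → X → ℝ}

theorem sum_mem_distortionCone {ι : Type*} (s : Finset ι) {F : ι → C(X, ℝ)}
    (hF : ∀ i ∈ s, F i ∈ distortionCone V) : ∑ i ∈ s, F i ∈ distortionCone V := by
  constructor
  · intro x
    rw [ContinuousMap.sum_apply]
    exact Finset.sum_nonneg fun i hi => (hF i hi).1 x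
  · intro x y
    rw [ContinuousMap.sum_apply, ContinuousMap.sum_apply, Finset.mul_sum]
    exact Finset.sum_le_sum fun i hi => (hF i hi).2 x y

theorem smul_mem_distortionCone {t : ℝ} (ht : 0 ≤ t) {Φ : C(X, ℝ)} (hΦ : Φ ∈ distortionCone V) :
    t • Φ ∈ distortionCone V := by
  refine ⟨fun x => mul_nonneg ht (hΦ.1 x), fun x y => ?_⟩
  have := mul_le_mul_of_nonneg_left (hΦ.2 x y) ht
  simp only [ContinuousMap.smul_apply, smul_eq_mul]
  linarith

theorem isClosed_distortionCone : IsClosed (distortionCone V) := by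
  have hev : ∀ x : X, Continuous fun Φ : C(X, ℝ) => Φ x := fun x =>
    ContinuousEvalConst.continuous_eval_const x
  have : distortionCone V = (⋂ x, {Φ : C(X, ℝ) | 0 ≤ Φ x}) ∩
      ⋂ x, ⋂ y, {Φ : C(X, ℝ) | Φ x ≤ V x y * Φ y} := by
    ext Φ
    simp [distortionCone]
  rw [this]
  exact (isClosed_iInter fun x => isClosed_le continuous_const (hev x)).inter
    (isClosed_iInter fun x => isClosed_iInter fun y => isClosed_le (hev x) ((hev y).const_mul _))

theorem pow_apply_one_mem_distortionCone {P : C(X, ℝ) →L[ℝ] C(X, ℝ)} (hV1 : ∀ x y, 1 ≤ V x y)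
    (hcone : ∀ Φ ∈ distortionCone V, P Φ ∈ distortionCone V) (n : ℕ) :
    (P ^ n) 1 ∈ distortionCone V := by
  induction n with
  | zero => exact ⟨fun x => zero_le_one, fun x y => by simpa using hV1 x y⟩
  | succ n ih =>
    rw [pow_succ']
    exact hcone _ ih

/-- A zero at `x` forces `Φ y ≤ V y x * Φ x = 0` for every `y`, against the normalisation. -/
theorem pos_of_mem_distortionCone [MeasurableSpace X] {ν : ProbabilityMeasure X} {Φ : C(X, ℝ)}
    (hΦ : Φ ∈ distortionCone V) (h1 : ∫ x, Φ x ∂(ν : Measure X) = 1) (x : X) : 0 < Φ x := by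
  refine lt_of_le_of_ne (hΦ.1 x) fun h0 => ?_
  have : ∀ y, Φ y = 0 := fun y => le_antisymm (by simpa [← h0] using hΦ.2 y x) (hΦ.1 y)
  simp [this] at h1

theorem integrable_continuousMap [CompactSpace X] [MeasurableSpace X] [OpensMeasurableSpace X]
    (ν : Measure X) [IsFiniteMeasure ν] (Φ : C(X, ℝ)) : Integrable (fun x => Φ x) ν :=
  Φ.continuous.integrable_of_hasCompactSupport (HasCompactSupport.of_compactSpace _)

/-- Two normalised positive eigenfunctions of an irreducible positive operator agree. -/
theorem eigenfunction_unique [CompactSpace X] [MeasurableSpace X]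
    {ν : ProbabilityMeasure X} {P : C(X, ℝ) →L[ℝ] C(X, ℝ)} {lam : ℝ}
    (hirr : ∀ g : C(X, ℝ), (∀ x, 0 ≤ g x) → P g = lam • g → ∀ x₀, g x₀ = 0 → g = 0)
    {h h' : C(X, ℝ)} (hpos : ∀ x, 0 < h x) (hPh : P h = lam • h) (hPh' : P h' = lam • h')
    (h1 : ∫ x, h x ∂(ν : Measure X) = 1) (h1' : ∫ x, h' x ∂(ν : Measure X) = 1) : h' = h := by
  have hX : Nonempty X := by
    by_contra hX
    rw [not_nonempty_iff] at hX
    rw [integral_of_isEmpty] at h1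
    exact zero_ne_one h1
  -- With `t` the minimum of `h' / h`, attained at `x₀`, the eigenfunction `h' - t • h` is
  -- nonnegative and vanishes at `x₀`, so irreducibility applies.
  obtain ⟨x₀, -, hx₀⟩ := isCompact_univ.exists_isMinOn (f := fun x => h' x / h x) Set.univ_nonempty
    (h'.continuous.div h.continuous fun x => (hpos x).ne').continuousOn
  set t := h' x₀ / h x₀
  have hmin : ∀ x, t ≤ h' x / h x := fun x => hx₀ (Set.mem_univ x)
  have hg := hirr (h' - t • h)
    (fun x => by
      have := (le_div_iff₀ (hpos x)).1 (hmin x)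
      simpa using this)
    (by rw [map_sub, map_smul, hPh, hPh', smul_sub, smul_comm]) x₀
    (by simp [t, div_mul_cancel₀ _ (hpos x₀).ne'])
  rw [sub_eq_zero] at hg
  have ht : t = 1 := by
    rw [hg] at h1'
    simpa [integral_const_mul, h1] using h1'
  rw [hg, ht, one_smul]

variable [CompactSpace X] [MeasurableSpace X] [OpensMeasurableSpace X]

theorem continuous_integral_continuousMap (ν : Measure X) [IsFiniteMeasure ν] :
    Continuous fun Φ : C(X, ℝ) => ∫ x, Φ x ∂ν := by
  refine (LipschitzWith.of_dist_le_mul (K := ⟨ν.real Set.univ, measureReal_nonneg⟩)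
    fun Φ Ψ => ?_).continuous
  rw [dist_eq_norm, ← integral_sub (integrable_continuousMap ν Φ) (integrable_continuousMap ν Ψ)]
  refine (norm_integral_le_of_norm_le_const (C := dist Φ Ψ) (.of_forall fun x => ?_)).trans_eq
    (mul_comm _ _)
  rw [← dist_eq_norm]
  exact ContinuousMap.dist_apply_le_dist x

variable {C : ℝ} {ν : ProbabilityMeasure X}

/-- Integrate `Φ x ≤ C * Φ y` over `y`. -/
theorem apply_le_of_mem_distortionCone (hVC : ∀ x y, V x y ≤ C) {Φ : C(X, ℝ)}
    (hΦ : Φ ∈ distortionCone V) (h1 : ∫ x, Φ x ∂(ν : Measure X) = 1) (x : X) : Φ x ≤ C := by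
  have h : ∀ y, Φ x ≤ C * Φ y := fun y =>
    (hΦ.2 x y).trans (mul_le_mul_of_nonneg_right (hVC x y) (hΦ.1 y))
  have := integral_mono (μ := (ν : Measure X)) (integrable_const _)
    ((integrable_continuousMap _ Φ).const_mul C) h
  simpa [integral_const_mul, h1] using this

/-- Arzelà–Ascoli: the cone inequality and the bound `Φ ≤ C` give `|Φ x - Φ y| ≤ (V x y - 1) * C`,
an equicontinuity estimate uniform over the set. -/
theorem isCompact_normalized_distortionCone (hVC : ∀ x y, V x y ≤ C) (hV0 : ∀ x y, 1 ≤ V x y)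
    (hsymm : ∀ x y, V x y = V y x) (hdiag : ∀ x, Tendsto (V x) (𝓝 x) (𝓝 1)) :
    IsCompact {Φ : C(X, ℝ) | Φ ∈ distortionCone V ∧ ∫ x, Φ x ∂(ν : Measure X) = 1} := by
  set A := {Φ : C(X, ℝ) | Φ ∈ distortionCone V ∧ ∫ x, Φ x ∂(ν : Measure X) = 1}
  have hAcl : IsClosed A := isClosed_distortionCone.inter
    (isClosed_eq (continuous_integral_continuousMap _) continuous_const)
  have hequi : ∀ x, ∀ ε > 0, ∀ᶠ y in 𝓝 x, ∀ Φ ∈ A, |Φ x - Φ y| < ε := by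
    intro x ε hε
    have ht : Tendsto (fun y => (V x y - 1) * C) (𝓝 x) (𝓝 0) := by
      simpa using ((hdiag x).sub_const 1).mul_const C
    filter_upwards [ht.eventually_lt_const hε] with y hy Φ hΦ
    have hx := apply_le_of_mem_distortionCone hVC hΦ.1 hΦ.2 x
    have hy' := apply_le_of_mem_distortionCone hVC hΦ.1 hΦ.2 y
    have h1 := hΦ.1.2 x y
    have h2 := hΦ.1.2 y x
    rw [hsymm] at h2
    have h3 := hV0 x y
    rw [abs_lt]
    constructor <;> nlinarith
  let e := ContinuousMap.isometryEquivBoundedOfCompact X ℝ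
  have := BoundedContinuousFunction.arzela_ascoli₂ (Set.Icc 0 C) isCompact_Icc (e.symm ⁻¹' A)
    (hAcl.preimage e.symm.continuous)
    (fun Φ x hΦ => ⟨hΦ.1.1 x, apply_le_of_mem_distortionCone hVC hΦ.1 hΦ.2 x⟩)
    (by
      intro x
      rw [Metric.equicontinuousAt_iff_right]
      intro ε hε
      filter_upwards [hequi x ε hε] with y hy Φ
      exact hy _ Φ.2)
  have h2 := this.image e.symm.continuous
  rwa [Set.image_preimage_eq _ e.symm.surjective] at h2

/-- If the dual of `P` has an eigenmeasure and `P` preserves the cone, then `P` has an eigenfunction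
in the cone. -/
theorem exists_eigenfunction {P : C(X, ℝ) →L[ℝ] C(X, ℝ)}
    (hVC : ∀ x y, V x y ≤ C) (hV0 : ∀ x y, 1 ≤ V x y)
    (hsymm : ∀ x y, V x y = V y x) (hdiag : ∀ x, Tendsto (V x) (𝓝 x) (𝓝 1))
    (hcone : ∀ Φ ∈ distortionCone V, P Φ ∈ distortionCone V) {lam : ℝ} (hlam : 0 < lam)
    (hν : ∀ Φ : C(X, ℝ), ∫ x, P Φ x ∂(ν : Measure X) = lam * ∫ x, Φ x ∂(ν : Measure X)) :
    ∃ h ∈ distortionCone V, ∫ x, h x ∂(ν : Measure X) = 1 ∧ P h = lam • h := by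
  set A := {Φ : C(X, ℝ) | Φ ∈ distortionCone V ∧ ∫ x, Φ x ∂(ν : Measure X) = 1}
  have hu : ∀ n, (lam ^ n)⁻¹ • (P ^ n) 1 ∈ A := by
    intro n
    refine ⟨smul_mem_distortionCone (by positivity) (pow_apply_one_mem_distortionCone hV0 hcone n),
      ?_⟩
    have : ∫ x, (P ^ n) 1 x ∂(ν : Measure X) = lam ^ n := by
      induction n with
      | zero => simp
      | succ n ih =>
        rw [pow_succ', pow_succ', ← ih]
        exact hν _
    simp only [ContinuousMap.smul_apply, smul_eq_mul, integral_const_mul, this]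
    field_simp
  -- Cesàro averages stay in the convex set `A`; they have `N + 1` terms so that `H 0` is normalised
  -- too.
  let H : ℕ → C(X, ℝ) := fun N =>
    ((N + 1 : ℕ) : ℝ)⁻¹ • ∑ n ∈ Finset.range (N + 1), (lam ^ n)⁻¹ • (P ^ n) 1
  have hH : ∀ N, H N ∈ A := by
    intro N
    refine ⟨smul_mem_distortionCone (by positivity)
      (sum_mem_distortionCone _ fun n _ => (hu n).1), ?_⟩
    simp only [H, ContinuousMap.smul_apply, smul_eq_mul, integral_const_mul,
      ContinuousMap.sum_apply]
    have hu' : ∀ n, ∫ x, (lam ^ n)⁻¹ * (P ^ n) 1 x ∂(ν : Measure X) = 1 := fun n => (hu n).2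
    rw [integral_finsetSum _ fun n _ => (integrable_continuousMap _ ((P ^ n) 1)).const_mul _]
    simp only [hu']
    simp only [Finset.sum_const, Finset.card_range, nsmul_eq_mul, mul_one]
    exact inv_mul_cancel₀ (by positivity)
  obtain ⟨h, hhA, φ, hφ, hlim⟩ :=
    (isCompact_normalized_distortionCone (ν := ν) hVC hV0 hsymm hdiag).tendsto_subseq hH
  refine ⟨h, hhA.1, hhA.2, ?_⟩
  -- Telescoping again: the defect is a uniformly bounded function divided by `N + 1`, so every
  -- limit point of `H` is an eigenfunction.
  have hkey : ∀ N, P (H N) - lam • H N =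
      ((N + 1 : ℕ) : ℝ)⁻¹ • lam • ((lam ^ (N + 1))⁻¹ • (P ^ (N + 1)) 1 - 1) := by
    intro N
    simp only [H, map_smul]
    rw [smul_comm lam, ← smul_sub, map_sum, Finset.smul_sum, ← Finset.sum_sub_distrib]
    congr 1
    induction N + 1 with
    | zero => simp
    | succ N ih =>
      rw [Finset.sum_range_succ, ih, map_smul, pow_succ' P]
      ext x
      simp only [ContinuousMap.add_apply, ContinuousMap.smul_apply, ContinuousMap.sub_apply,
        smul_eq_mul, ContinuousMap.one_apply, mul_apply_eq_comp]
      field_simp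
      ring
  have hzero : Tendsto (fun N => P (H N) - lam • H N) atTop (𝓝 0) := by
    have hb : ∀ N : ℕ, ‖P (H N) - lam • H N‖ ≤ lam * (C + 1) / ((N : ℝ) + 1) := by
      intro N
      rw [hkey, norm_smul, norm_smul, Real.norm_of_nonneg hlam.le, Real.norm_of_nonneg
        (by positivity), div_eq_inv_mul, Nat.cast_succ]
      refine mul_le_mul_of_nonneg_left (mul_le_mul_of_nonneg_left ?_ hlam.le) (by positivity)
      have hC0 : ∀ x : X, 0 ≤ C := fun x => zero_le_one.trans ((hV0 x x).trans (hVC x x))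
      have hx₀ : Nonempty X := by
        by_contra hX
        rw [not_nonempty_iff] at hX
        have := hhA.2
        rw [integral_of_isEmpty] at this
        exact zero_ne_one this
      obtain ⟨x₀⟩ := hx₀
      rw [ContinuousMap.norm_le _ (by linarith [hC0 x₀])]
      intro x
      have h1 := (hu (N + 1)).1.1 x
      have h2 := apply_le_of_mem_distortionCone hVC (hu (N + 1)).1 (hu (N + 1)).2 x
      rw [ContinuousMap.sub_apply, ContinuousMap.one_apply, Real.norm_eq_abs, abs_le]
      exact ⟨by linarith only [h1, hC0 x₀], by linarith only [h2, hC0 x₀]⟩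
    refine squeeze_zero_norm hb ?_
    have := (tendsto_one_div_add_atTop_nhds_zero_nat (𝕜 := ℝ)).const_mul (lam * (C + 1))
    simpa [mul_one_div, div_eq_mul_inv] using this
  have h1 := hzero.comp hφ.tendsto_atTop
  have h2 : Tendsto (fun k => P (H (φ k)) - lam • H (φ k)) atTop (𝓝 (P h - lam • h)) :=
    ((P.continuous.tendsto h).comp hlim).sub (hlim.const_smul lam)
  exact sub_eq_zero.1 (tendsto_nhds_unique h2 h1)

end Cone

/-! ### Transfer operators averaged over random branches -/

/-- A nonempty open set contains a nonempty open cylinder, whose mass is a finite product of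
positive numbers. -/
theorem isOpenPosMeasure_infinitePi {ι : Type*} {Y : ι → Type*} [∀ i, TopologicalSpace (Y i)]
    [∀ i, MeasurableSpace (Y i)] [∀ i, OpensMeasurableSpace (Y i)] (μ : ∀ i, Measure (Y i))
    [∀ i, IsProbabilityMeasure (μ i)] [∀ i, (μ i).IsOpenPosMeasure] :
    (Measure.infinitePi μ).IsOpenPosMeasure := by
  refine ⟨fun U hU ⟨a, ha⟩ => ?_⟩
  obtain ⟨I, u, hu, hsub⟩ := isOpen_pi_iff.1 hU a ha
  refine ((pos_iff_ne_zero.2 ?_).trans_le (measure_mono hsub)).ne'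
  rw [Measure.infinitePi_pi _ fun i hi => (hu i hi).1.measurableSet]
  exact Finset.prod_ne_zero_iff.2 fun i hi => ((hu i hi).1.measure_pos _ ⟨_, (hu i hi).2⟩).ne'

section TransferOperator

variable {W X : Type*} [TopologicalSpace W] [MeasurableSpace W] [OpensMeasurableSpace W]
  [TopologicalSpace X] (m : Measure W) [IsProbabilityMeasure m] (S : C(W × X, X)) (f : C(X, ℝ))

theorem integrable_averagedTransfer [CompactSpace W] (Φ : C(X, ℝ)) (x : X) :
    Integrable (fun w => Real.exp (f (S (w, x))) * Φ (S (w, x))) m :=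
  integrable_continuousMap m ⟨fun w => Real.exp (f (S (w, x))) * Φ (S (w, x)), by fun_prop⟩

variable [CompactSpace X] [FirstCountableTopology X]

theorem continuous_integral_comp (G : C(X, ℝ)) : Continuous fun x => ∫ w, G (S (w, x)) ∂m := by
  refine continuous_of_dominated (bound := fun _ => ‖G‖) (fun x => ?_)
    (fun x => .of_forall fun w => G.norm_coe_le_norm _) (integrable_const _)
    (.of_forall fun w => by fun_prop)
  exact (Continuous.aestronglyMeasurable (by fun_prop))

variable [CompactSpace W]

/-- The transfer operator with potential `f` of a family of inverse branches `S (w, ·)` whose index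
`w` has distribution `m`. -/
noncomputable def averagedTransfer : C(X, ℝ) →L[ℝ] C(X, ℝ) :=
  LinearMap.mkContinuous
    { toFun := fun Φ => ⟨fun x => ∫ w, Real.exp (f (S (w, x))) * Φ (S (w, x)) ∂m,
        continuous_integral_comp m S (⟨fun x => Real.exp (f x), by fun_prop⟩ * Φ)⟩
      map_add' := fun Φ Ψ => by
        ext x
        simp only [ContinuousMap.coe_mk, ContinuousMap.add_apply, mul_add]
        exact integral_add (integrable_averagedTransfer m S f Φ x)
          (integrable_averagedTransfer m S f Ψ x)
      map_smul' := fun t Φ => by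
        ext x
        simp only [ContinuousMap.coe_mk, ContinuousMap.smul_apply, smul_eq_mul, RingHom.id_apply,
          mul_left_comm _ t, integral_const_mul] }
    (Real.exp ‖f‖) fun Φ => by
      rw [ContinuousMap.norm_le _ (by positivity)]
      intro x
      refine (norm_integral_le_of_norm_le_const (C := Real.exp ‖f‖ * ‖Φ‖)
        (.of_forall fun w => ?_)).trans_eq (by simp)
      rw [norm_mul, Real.norm_of_nonneg (Real.exp_pos _).le]
      exact mul_le_mul (Real.exp_le_exp.2 ((le_abs_self _).trans (f.norm_coe_le_norm _)))
        (Φ.norm_coe_le_norm _) (norm_nonneg _) (Real.exp_pos _).le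

theorem averagedTransfer_apply (Φ : C(X, ℝ)) (x : X) :
    averagedTransfer m S f Φ x = ∫ w, Real.exp (f (S (w, x))) * Φ (S (w, x)) ∂m := rfl

theorem averagedTransfer_nonneg (Φ : C(X, ℝ)) (hΦ : ∀ x, 0 ≤ Φ x) (x : X) :
    0 ≤ averagedTransfer m S f Φ x :=
  integral_nonneg fun _ => mul_nonneg (Real.exp_pos _).le (hΦ _)

theorem le_averagedTransfer_one (x : X) :
    Real.exp (-‖f‖) ≤ averagedTransfer m S f 1 x := by
  have := integral_mono (μ := m) (integrable_const (Real.exp (-‖f‖)))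
    (integrable_averagedTransfer m S f 1 x) fun _ => by
      simpa using (abs_le.1 (f.norm_coe_le_norm (S (_, x)))).1
  simpa [averagedTransfer_apply] using this

/-- The factor `V x y` does not depend on the branch `w`, so the branchwise inequality can be
integrated over `w`. -/
theorem averagedTransfer_mem_distortionCone {V : X → X → ℝ}
    (hV : ∀ w x y, Real.exp (f (S (w, x))) * V (S (w, x)) (S (w, y)) ≤
      V x y * Real.exp (f (S (w, y)))) {Φ : C(X, ℝ)} (hΦ : Φ ∈ distortionCone V) :
    averagedTransfer m S f Φ ∈ distortionCone V := by
  refine ⟨averagedTransfer_nonneg m S f Φ hΦ.1, fun x y => ?_⟩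
  rw [averagedTransfer_apply, averagedTransfer_apply, ← integral_const_mul]
  refine integral_mono (integrable_averagedTransfer m S f Φ x)
    ((integrable_averagedTransfer m S f Φ y).const_mul _) fun w => ?_
  calc Real.exp (f (S (w, x))) * Φ (S (w, x))
      ≤ Real.exp (f (S (w, x))) * (V (S (w, x)) (S (w, y)) * Φ (S (w, y))) :=
        mul_le_mul_of_nonneg_left (hΦ.2 _ _) (Real.exp_pos _).le
    _ = Real.exp (f (S (w, x))) * V (S (w, x)) (S (w, y)) * Φ (S (w, y)) := by ring
    _ ≤ V x y * Real.exp (f (S (w, y))) * Φ (S (w, y)) :=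
        mul_le_mul_of_nonneg_right (hV w x y) (hΦ.1 _)
    _ = _ := by ring

/-- A nonnegative eigenfunction vanishes on a set that is invariant under the inverse branches. -/
theorem eq_zero_of_averagedTransfer_eq_smul [m.IsOpenPosMeasure]
    {g : C(X, ℝ)} (hg : ∀ x, 0 ≤ g x) {lam : ℝ} (hPg : averagedTransfer m S f g = lam • g)
    {x : X} (hx : g x = 0) (w : W) : g (S (w, x)) = 0 := by
  have h0 : ∫ w, Real.exp (f (S (w, x))) * g (S (w, x)) ∂m = 0 := by
    rw [← averagedTransfer_apply, hPg]
    simp [hx]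
  have hcont : Continuous fun w => Real.exp (f (S (w, x))) * g (S (w, x)) := by fun_prop
  -- Full support of `m` upgrades vanishing almost everywhere to vanishing for every `w`, as the
  -- integrand is continuous.
  rw [integral_eq_zero_iff_of_nonneg (fun w => mul_nonneg (Real.exp_pos _).le (hg _))
    (integrable_averagedTransfer m S f g x), hcont.ae_eq_iff_eq _ continuous_zero] at h0
  simpa [(Real.exp_pos _).ne'] using congrFun h0 w

end TransferOperator

/-! ### The metric of the lattice -/

section Metric

variable {dI : unitInterval → unitInterval → ℝ}

theorem IsIntervalMetric.continuous (hdI : IsIntervalMetric dI) :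
    Continuous fun q : unitInterval × unitInterval => dI q.1 q.2 :=
  letI := PseudoMetricSpace.ofDistTopology dI hdI.self hdI.symm hdI.triangle hdI.isOpen_iff
  continuous_dist

theorem IsIntervalMetric.nonneg (hdI : IsIntervalMetric dI) (x y : unitInterval) : 0 ≤ dI x y := by
  have := hdI.triangle x y x
  rw [hdI.self, hdI.symm y x] at this
  linarith

theorem IsIntervalMetric.exists_bound (hdI : IsIntervalMetric dI) :
    ∃ D, 0 ≤ D ∧ ∀ x y, dI x y ≤ D := by
  obtain ⟨q, -, hq⟩ := isCompact_univ.exists_isMaxOn Set.univ_nonempty hdI.continuous.continuousOn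
  exact ⟨dI q.1 q.2, hdI.nonneg _ _, fun x y => hq (Set.mem_univ (x, y))⟩

variable {θ : ℝ}

theorem weighted_dist_le (hdI : IsIntervalMetric dI) (hθ0 : 0 < θ) (hθ1 : θ < 1)
    (x y : unitInterval) (n : ℕ) : θ ^ n * dI x y ≤ dI x y :=
  mul_le_of_le_one_left (hdI.nonneg _ _) (pow_le_one₀ hθ0.le hθ1.le)

theorem weighted_dist_le_latticeDist (hdI : IsIntervalMetric dI) (hθ0 : 0 < θ) (hθ1 : θ < 1)
    (x y : Lattice) (k : ℤ) : θ ^ k.natAbs * dI (x k) (y k) ≤ latticeDist dI θ x y := by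
  obtain ⟨D, -, hD⟩ := hdI.exists_bound
  refine le_ciSup (f := fun k : ℤ => θ ^ k.natAbs * dI (x k) (y k)) ⟨D, ?_⟩ k
  rintro _ ⟨k, rfl⟩
  exact (weighted_dist_le hdI hθ0 hθ1 _ _ _).trans (hD _ _)

theorem latticeDist_nonneg (hdI : IsIntervalMetric dI) (hθ0 : 0 < θ) (x y : Lattice) :
    0 ≤ latticeDist dI θ x y :=
  Real.iSup_nonneg fun _ => mul_nonneg (by positivity) (hdI.nonneg _ _)

theorem latticeDist_symm (hdI : IsIntervalMetric dI) (x y : Lattice) :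
    latticeDist dI θ x y = latticeDist dI θ y x := by
  simp only [latticeDist, hdI.symm]

theorem eq_of_latticeDist_eq_zero (hdI : IsIntervalMetric dI) (hθ0 : 0 < θ) (hθ1 : θ < 1)
    {x y : Lattice} (h : latticeDist dI θ x y = 0) : x = y := by
  funext k
  have h1 := weighted_dist_le_latticeDist hdI hθ0 hθ1 x y k
  rw [h] at h1
  exact hdI.eq_of_zero _ _ (le_antisymm (nonpos_of_mul_nonpos_right h1 (by positivity))
    (hdI.nonneg _ _))

theorem latticeDist_le_mul (hdI : IsIntervalMetric dI) (hθ0 : 0 < θ) (hθ1 : θ < 1) {η : ℝ}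
    (hη : 0 ≤ η) {x y x' y' : Lattice} (h : ∀ k, dI (x' k) (y' k) ≤ η * dI (x k) (y k)) :
    latticeDist dI θ x' y' ≤ η * latticeDist dI θ x y := by
  refine ciSup_le fun k => ?_
  calc θ ^ k.natAbs * dI (x' k) (y' k) ≤ θ ^ k.natAbs * (η * dI (x k) (y k)) :=
        mul_le_mul_of_nonneg_left (h k) (by positivity)
    _ = η * (θ ^ k.natAbs * dI (x k) (y k)) := by ring
    _ ≤ _ := mul_le_mul_of_nonneg_left (weighted_dist_le_latticeDist hdI hθ0 hθ1 x y k) hη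

theorem tendsto_latticeDist (hdI : IsIntervalMetric dI) (hθ0 : 0 < θ) (hθ1 : θ < 1)
    (x : Lattice) : Tendsto (latticeDist dI θ x) (𝓝 x) (𝓝 0) := by
  obtain ⟨D, hD0, hD⟩ := hdI.exists_bound
  refine tendsto_order.2 ⟨fun a ha => .of_forall fun y =>
    ha.trans_le (latticeDist_nonneg hdI hθ0 x y), fun ε hε => ?_⟩
  -- Sites beyond `K` contribute at most `θ ^ K * D`; the finitely many others are handled by
  -- continuity. The margin `ε / 2` is needed because a supremum of strict bounds is only bounded
  -- weakly.
  obtain ⟨K, hK⟩ := (((tendsto_pow_atTop_nhds_zero_of_lt_one hθ0.le hθ1).mul_const D).eventually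
    (gt_mem_nhds (a := ε / 2) (by simpa using half_pos hε))).exists
  have hnear : ∀ᶠ y in 𝓝 x, ∀ k ∈ Finset.Icc (-(K : ℤ)) K, dI (x k) (y k) < ε / 2 := by
    refine (Finset.eventually_all _).2 fun k _ => ?_
    have hc : Continuous fun y : Lattice => dI (x k) (y k) :=
      hdI.continuous.comp (continuous_const.prodMk (continuous_apply k))
    have := hc.tendsto x
    rw [hdI.self] at this
    exact this.eventually_lt_const (half_pos hε)
  filter_upwards [hnear] with y hy
  refine (ciSup_le fun k => ?_).trans_lt (half_lt_self hε)
  by_cases hk : k ∈ Finset.Icc (-(K : ℤ)) K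
  · exact (weighted_dist_le hdI hθ0 hθ1 _ _ _).trans (hy k hk).le
  · have hk' : K ≤ k.natAbs := by
      rw [Finset.mem_Icc] at hk
      omega
    calc θ ^ k.natAbs * dI (x k) (y k) ≤ θ ^ K * D :=
          mul_le_mul (pow_le_pow_of_le_one hθ0.le hθ1.le hk') (hD _ _) (hdI.nonneg _ _)
            (by positivity)
      _ ≤ ε / 2 := hK.le

end Metric

/-! ### Finite-box approximation and Hölder continuity -/

theorem tendsto_proj (p : unitInterval) (x : Lattice) :
    Tendsto (fun k => proj p k x) atTop (𝓝 x) := by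
  rw [tendsto_pi_nhds]
  intro i
  refine tendsto_const_nhds.congr' ?_
  filter_upwards [eventually_ge_atTop i.natAbs] with k hk
  have : i ∈ box k := by
    rw [Finset.mem_Icc]
    omega
  simp [proj, this]

/-- A function of finite Hölder constant is Hölder continuous on the whole lattice. -/
theorem abs_sub_le_holderConst {dI : unitInterval → unitInterval → ℝ} (hdI : IsIntervalMetric dI)
    {θ β : ℝ} (hθ0 : 0 < θ) (hθ1 : θ < 1) {p : unitInterval} {f : C(Lattice, ℝ)}
    (hf : f ∈ holderSpace dI θ β p) (x y : Lattice) :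
    |f x - f y| ≤ (holderConst dI θ β p f).toReal * latticeDist dI θ x y ^ β := by
  have hfin : holderConst dI θ β p f ≠ ⊤ := (ENNReal.add_lt_top.1 hf).2.ne
  -- At distance zero the points coincide. Otherwise the quotient can be cleared for each `k`, and
  -- the bound passes to the limit because `proj p k x` tends to `x`.
  rcases (latticeDist_nonneg hdI hθ0 x y).eq_or_lt with h0 | hpos
  · rw [eq_of_latticeDist_eq_zero hdI hθ0 hθ1 h0.symm, sub_self, abs_zero]
    exact mul_nonneg ENNReal.toReal_nonneg (Real.rpow_nonneg (latticeDist_nonneg hdI hθ0 _ _) _)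
  · have hlim : Tendsto (fun k => |f (proj p k x) - f (proj p k y)|) atTop (𝓝 |f x - f y|) :=
      (((f.continuous.tendsto x).comp (tendsto_proj p x)).sub
        ((f.continuous.tendsto y).comp (tendsto_proj p y))).abs
    refine le_of_tendsto' hlim fun k => ?_
    have hle : ENNReal.ofReal (|f (proj p k x) - f (proj p k y)| / latticeDist dI θ x y ^ β) ≤
        holderConst dI θ β p f :=
      le_iSup_of_le k (le_iSup_of_le x (le_iSup_of_le y le_rfl))
    rw [← div_le_iff₀ (Real.rpow_pos_of_pos hpos _)]
    exact (ENNReal.ofReal_le_iff_le_toReal hfin).1 hle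

/-! ### Independent branches and the identification of `P` -/

variable {b : ℕ} {ζ : Fin b → unitInterval → unitInterval}

/-- The inverse branches of the product map on the whole lattice. -/
noncomputable def latticeBranch (hζ : ∀ j, Continuous (ζ j)) :
    C((ℤ → Fin b) × Lattice, Lattice) where
  toFun q i := ζ (q.1 i) (q.2 i)
  continuous_toFun := by
    refine continuous_pi fun i => ?_
    have h : Continuous fun q : Fin b × unitInterval => ζ q.1 q.2 :=
      continuous_prod_of_discrete_left.2 hζ
    exact Continuous.comp (f := fun q : (ℤ → Fin b) × Lattice => (q.1 i, q.2 i)) h (by fun_prop)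

/-- The uniform distribution on the branches. -/
noncomputable def uniformBranch (b : ℕ) [Nonempty (Fin b)] : Measure (Fin b) :=
  (PMF.uniformOfFintype (Fin b)).toMeasure

instance [Nonempty (Fin b)] : IsProbabilityMeasure (uniformBranch b) :=
  PMF.toMeasure.isProbabilityMeasure _

theorem uniformBranch_singleton [Nonempty (Fin b)] (j : Fin b) :
    uniformBranch b {j} = (b : ENNReal)⁻¹ := by
  rw [uniformBranch, PMF.toMeasure_apply_singleton _ _ (measurableSet_singleton j)]
  simp

instance [Nonempty (Fin b)] : (uniformBranch b).IsOpenPosMeasure := by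
  refine ⟨fun U _ ⟨j, hj⟩ => ?_⟩
  refine ((pos_iff_ne_zero.2 ?_).trans_le (measure_mono (Set.singleton_subset_iff.2 hj))).ne'
  rw [uniformBranch_singleton]
  exact ENNReal.inv_ne_zero.2 (ENNReal.natCast_ne_top b)

/-- Independent uniform choices of a branch at every site. -/
noncomputable def branchMeasure (b : ℕ) [Nonempty (Fin b)] : Measure (ℤ → Fin b) :=
  Measure.infinitePi fun _ => uniformBranch b

instance [Nonempty (Fin b)] : IsProbabilityMeasure (branchMeasure b) := by
  unfold branchMeasure
  infer_instance

instance [Nonempty (Fin b)] : (branchMeasure b).IsOpenPosMeasure :=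
  isOpenPosMeasure_infinitePi _

theorem proj_latticeBranch (hζ : ∀ j, Continuous (ζ j)) (p : unitInterval) (k : ℕ)
    (w : ℤ → Fin b) (x : Lattice) :
    proj p k (latticeBranch hζ (w, x)) = proj p k (inverseBranch ζ k ((box k).restrict w) x) := by
  funext i
  by_cases hi : i ∈ box k
  · simp only [proj, hi, if_true, inverseBranch, dif_pos, latticeBranch]
    rfl
  · simp only [proj, hi, if_false]

/-- Only the restriction of `w` to the box matters, and under the product measure each of the
finitely many restrictions has mass `b⁻¹ ^ (2 * k + 1)`. -/
theorem transferApprox_eq_integral [Nonempty (Fin b)] (hζ : ∀ j, Continuous (ζ j))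
    (p : unitInterval) (f Φ : C(Lattice, ℝ)) (k : ℕ) (x : Lattice) :
    transferApprox ζ p f k Φ x = ∫ w, Real.exp (f (proj p k (latticeBranch hζ (w, x)))) *
      Φ (proj p k (latticeBranch hζ (w, x))) ∂branchMeasure b := by
  simp only [proj_latticeBranch]
  refine Eq.trans ?_ (integral_restrict_infinitePi (μ := fun _ : ℤ => uniformBranch b) (s := box k)
    (f := fun w : box k → Fin b => Real.exp (f (proj p k (inverseBranch ζ k w x))) *
      Φ (proj p k (inverseBranch ζ k w x))) (Measurable.of_discrete).aestronglyMeasurable).symm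
  rw [integral_fintype (.of_finite), transferApprox, Finset.mul_sum]
  refine Finset.sum_congr rfl fun w _ => ?_
  rw [measureReal_def, Measure.pi_singleton]
  simp only [uniformBranch_singleton, Finset.prod_const, ENNReal.toReal_pow, ENNReal.toReal_inv,
    ENNReal.toReal_natCast, smul_eq_mul, Finset.card_univ, Fintype.card_coe, Int.card_Icc, one_div,
    inv_pow]
  congr 3
  omega

theorem tendsto_transferApprox [Nonempty (Fin b)] (hζ : ∀ j, Continuous (ζ j))
    (p : unitInterval) (f Φ : C(Lattice, ℝ)) (x : Lattice) :
    Tendsto (fun k => transferApprox ζ p f k Φ x) atTop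
      (𝓝 (averagedTransfer (branchMeasure b) (latticeBranch hζ) f Φ x)) := by
  simp only [transferApprox_eq_integral hζ]
  rw [averagedTransfer_apply]
  refine tendsto_integral_of_dominated_convergence (fun _ => Real.exp ‖f‖ * ‖Φ‖) (fun k => ?_)
    (integrable_const _) (fun k => .of_forall fun w => ?_) (.of_forall fun w => ?_)
  · have hproj : Continuous (proj p k) := by
      refine continuous_pi fun i => ?_
      by_cases hi : i ∈ box k
      · simpa only [proj, hi, if_true] using continuous_apply i
      · simpa only [proj, hi, if_false] using continuous_const
    exact Continuous.aestronglyMeasurable (by fun_prop)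
  · rw [norm_mul, Real.norm_of_nonneg (Real.exp_pos _).le]
    exact mul_le_mul (Real.exp_le_exp.2 ((le_abs_self _).trans (f.norm_coe_le_norm _)))
      (Φ.norm_coe_le_norm _) (norm_nonneg _) (Real.exp_pos _).le
  · have h := tendsto_proj p (latticeBranch hζ (w, x))
    exact (((Real.continuous_exp.comp f.continuous).tendsto _).comp h).mul
      ((Φ.continuous.tendsto _).comp h)

theorem transfer_eq_averagedTransfer [Nonempty (Fin b)] (hζ : ∀ j, Continuous (ζ j))
    (p : unitInterval) (f Φ : C(Lattice, ℝ)) (x : Lattice) :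
    transfer ζ p f Φ x = averagedTransfer (branchMeasure b) (latticeBranch hζ) f Φ x :=
  (tendsto_transferApprox hζ p f Φ x).limUnder_eq

theorem HasFullBranches.nonempty {τ : unitInterval → unitInterval} (hτ : HasFullBranches τ ζ) :
    Nonempty (Fin b) :=
  ⟨(hτ.branch_of 0).choose⟩

/-! ### Distortion of the potential -/

section Distortion

variable {dI : unitInterval → unitInterval → ℝ} {θ β η : ℝ} {p : unitInterval} {f : C(Lattice, ℝ)}

theorem distortion_exponent_nonneg (hβ : 0 < β) (hη0 : 0 < η) (hη1 : η < 1) :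
    0 ≤ (holderConst dI θ β p f).toReal * (η ^ β / (1 - η ^ β)) :=
  mul_nonneg ENNReal.toReal_nonneg (div_nonneg (Real.rpow_nonneg hη0.le _)
    (sub_nonneg.2 (Real.rpow_le_one hη0.le hη1.le hβ.le)))

theorem distortion_mono (hβ : 0 < β) (hη0 : 0 < η) (hη1 : η < 1) {z z' : ℝ} (hz : 0 ≤ z)
    (h : z ≤ z') : distortion dI θ β η p f z ≤ distortion dI θ β η p f z' :=
  Real.exp_le_exp.2 (mul_le_mul_of_nonneg_left (Real.rpow_le_rpow hz h hβ.le)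
    (distortion_exponent_nonneg hβ hη0 hη1))

theorem distortion_zero (hβ : 0 < β) : distortion dI θ β η p f 0 = 1 := by
  simp [distortion, Real.zero_rpow hβ.ne']

theorem continuous_distortion (hβ : 0 < β) : Continuous (distortion dI θ β η p f) :=
  Real.continuous_exp.comp (continuous_const.mul (Real.continuous_rpow_const hβ.le))

/-- The distortion function absorbs the variation of the potential along one contracting branch. -/
theorem exp_mul_distortion_le (hdI : IsIntervalMetric dI) (hθ0 : 0 < θ) (hθ1 : θ < 1)
    (hβ : 0 < β) (hη0 : 0 < η) (hη1 : η < 1) (hf : f ∈ holderSpace dI θ β p)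
    {x y x' y' : Lattice} (h : ∀ k, dI (x' k) (y' k) ≤ η * dI (x k) (y k)) :
    Real.exp (f x') * distortion dI θ β η p f (latticeDist dI θ x' y') ≤
      distortion dI θ β η p f (latticeDist dI θ x y) * Real.exp (f y') := by
  have hd := latticeDist_le_mul hdI hθ0 hθ1 hη0.le h
  have hd0 := latticeDist_nonneg hdI hθ0 x' y'
  have hpow : latticeDist dI θ x' y' ^ β ≤ η ^ β * latticeDist dI θ x y ^ β := by
    rw [← Real.mul_rpow hη0.le (latticeDist_nonneg hdI hθ0 x y)]
    exact Real.rpow_le_rpow hd0 hd hβ.le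
  have hfxy := (le_abs_self _).trans (abs_sub_le_holderConst hdI hθ0 hθ1 hf x' y')
  have hlt : η ^ β < 1 := Real.rpow_lt_one hη0.le hη1 hβ
  have hc := distortion_exponent_nonneg (dI := dI) (θ := θ) (p := p) (f := f) hβ hη0 hη1
  rw [distortion, distortion, ← Real.exp_add, ← Real.exp_add, Real.exp_le_exp]
  have hL : 0 ≤ (holderConst dI θ β p f).toReal := ENNReal.toReal_nonneg
  set L := (holderConst dI θ β p f).toReal
  set c := L * (η ^ β / (1 - η ^ β))
  -- This identity dictates the constant in `B`: one step costs `L` from the potential plus `c` from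
  -- the previous distortion, and contraction by `η ^ β` returns exactly `c`.
  have hid : (L + c) * η ^ β = c := by
    have : 1 - η ^ β ≠ 0 := (sub_pos.2 hlt).ne'
    simp only [c]
    field_simp
    ring
  have := mul_le_mul_of_nonneg_left hpow (add_nonneg hL hc)
  rw [← mul_assoc, hid, add_mul] at this
  linarith

end Distortion

/-! ### Density of backward orbits -/

/-- The backward orbit of any point under the inverse branches is dense. -/
theorem dense_of_invariant {dI : unitInterval → unitInterval → ℝ} (hdI : IsIntervalMetric dI)
    {η : ℝ} (hη0 : 0 < η) (hη1 : η < 1) {τ : unitInterval → unitInterval}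
    (hτ : HasFullBranches τ ζ) (hζ : IsExpanding dI η ζ) {Z : Set Lattice} (hZ : IsClosed Z)
    (hne : Z.Nonempty) (hinv : ∀ w, ∀ x ∈ Z, latticeBranch hτ.continuous (w, x) ∈ Z) :
    Z = Set.univ := by
  obtain ⟨D, hD0, hD⟩ := hdI.exists_bound
  -- Approximate the image of `y` under `τ` at every site, then pull back through the branches
  -- containing the coordinates of `y`. The error shrinks by `η`, uniformly over the sites.
  have happrox : ∀ (n : ℕ) (y : Lattice), ∃ z ∈ Z, ∀ i, dI (y i) (z i) ≤ η ^ n * D := by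
    intro n
    induction n with
    | zero =>
      obtain ⟨z, hz⟩ := hne
      exact fun y => ⟨z, hz, fun i => by simpa using hD _ _⟩
    | succ n ih =>
      intro y
      obtain ⟨z, hz, hyz⟩ := ih fun i => τ (y i)
      choose w hw using fun i => hτ.branch_of (y i)
      refine ⟨_, hinv w z hz, fun i => ?_⟩
      calc dI (y i) (ζ (w i) (z i)) = dI (ζ (w i) (τ (y i))) (ζ (w i) (z i)) := by rw [hw]
        _ ≤ η * dI (τ (y i)) (z i) := hζ _ _ _
        _ ≤ η * (η ^ n * D) := mul_le_mul_of_nonneg_left (hyz i) hη0.le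
        _ = η ^ (n + 1) * D := by ring
  refine Set.eq_univ_of_forall fun y => ?_
  choose z hz hyz using fun n => happrox n y
  refine hZ.mem_of_tendsto (b := atTop) (f := z) ?_ (.of_forall hz)
  rw [tendsto_pi_nhds]
  intro i
  rw [tendsto_nhds]
  intro s hs hys
  obtain ⟨ε, hε, hsub⟩ := (hdI.isOpen_iff s).1 hs _ hys
  have h0 : Tendsto (fun n => η ^ n * D) atTop (𝓝 0) := by
    simpa using (tendsto_pow_atTop_nhds_zero_of_lt_one hη0.le hη1).mul_const D
  filter_upwards [h0.eventually_lt_const hε] with n hn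
  exact hsub _ ((hyz n i).trans_lt hn)

end LatticeMap

/-! ### The main theorem -/

theorem mainTheorem6
    (dI : unitInterval → unitInterval → ℝ) (hdI : LatticeMap.IsIntervalMetric dI)
    (θ : ℝ) (hθ0 : 0 < θ) (hθ1 : θ < 1)
    (β : ℝ) (hβ : 0 < β)
    (η : ℝ) (hη0 : 0 < η) (hη1 : η < 1)
    (τ : unitInterval → unitInterval) (b : ℕ) (ζ : Fin b → unitInterval → unitInterval)
    (hτ : LatticeMap.HasFullBranches τ ζ) (hζ : LatticeMap.IsExpanding dI η ζ)
    (p : unitInterval) (hp : τ p = p)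
    (f : C(LatticeMap.Lattice, ℝ)) (hf : f ∈ LatticeMap.holderSpace dI θ β p) :
    -- the operator `P` is well defined
    (∀ (Φ : C(LatticeMap.Lattice, ℝ)) (x : LatticeMap.Lattice),
      Tendsto (fun k => LatticeMap.transferApprox ζ p f k Φ x) atTop
        (𝓝 (LatticeMap.transfer ζ p f Φ x))) ∧
    -- an eigenmeasure exists
    (∃ (ν : ProbabilityMeasure LatticeMap.Lattice) (lam : ℝ),
      LatticeMap.IsEigenmeasure ζ p f ν lam) ∧
    -- and for each of them there is exactly one `h`, which is strictly positive
    ∀ (ν : ProbabilityMeasure LatticeMap.Lattice) (lam : ℝ),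
      LatticeMap.IsEigenmeasure ζ p f ν lam →
      ∃ h ∈ LatticeMap.densitySet dI θ β η p f ν,
        (∀ x, LatticeMap.transfer ζ p f h x = lam * h x) ∧
        (∀ x, 0 < h x) ∧
        ∀ h' ∈ LatticeMap.densitySet dI θ β η p f ν,
          (∀ x, LatticeMap.transfer ζ p f h' x = lam * h' x) → h' = h := by

  have hb := hτ.nonempty
  set P := LatticeMap.averagedTransfer (LatticeMap.branchMeasure b)
    (LatticeMap.latticeBranch hτ.continuous) f with hP
  have htransfer : ∀ Φ x, LatticeMap.transfer ζ p f Φ x = P Φ x :=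
    LatticeMap.transfer_eq_averagedTransfer hτ.continuous p f
  set V : LatticeMap.Lattice → LatticeMap.Lattice → ℝ := fun x y =>
    LatticeMap.distortion dI θ β η p f (LatticeMap.latticeDist dI θ x y) with hV
  obtain ⟨D, hD0, hD⟩ := hdI.exists_bound
  have hVC : ∀ x y, V x y ≤ LatticeMap.distortion dI θ β η p f D := fun x y =>
    LatticeMap.distortion_mono hβ hη0 hη1 (LatticeMap.latticeDist_nonneg hdI hθ0 x y)
      (ciSup_le fun k => (LatticeMap.weighted_dist_le hdI hθ0 hθ1 _ _ _).trans (hD _ _))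
  have hV1 : ∀ x y, 1 ≤ V x y := fun x y => by
    rw [← LatticeMap.distortion_zero (dI := dI) (θ := θ) (η := η) (p := p) (f := f) hβ]
    exact LatticeMap.distortion_mono hβ hη0 hη1 le_rfl (LatticeMap.latticeDist_nonneg hdI hθ0 x y)
  have hsymm : ∀ x y, V x y = V y x := fun x y => by
    simp only [hV, LatticeMap.latticeDist_symm hdI x y]
  have hdiag : ∀ x, Tendsto (V x) (𝓝 x) (𝓝 1) := fun x => by
    rw [← LatticeMap.distortion_zero (dI := dI) (θ := θ) (η := η) (p := p) (f := f) hβ]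
    exact ((LatticeMap.continuous_distortion hβ).tendsto 0).comp
      (LatticeMap.tendsto_latticeDist hdI hθ0 hθ1 x)
  have hcone : ∀ Φ ∈ LatticeMap.distortionCone V, P Φ ∈ LatticeMap.distortionCone V := fun Φ hΦ =>
    LatticeMap.averagedTransfer_mem_distortionCone _ _ _ (fun w x y =>
      LatticeMap.exp_mul_distortion_le hdI hθ0 hθ1 hβ hη0 hη1 hf fun k => hζ _ _ _) hΦ
  refine ⟨fun Φ x => ?_, ?_, fun ν lam hν => ?_⟩
  · rw [htransfer]
    exact LatticeMap.tendsto_transferApprox hτ.continuous p f Φ x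
  -- The lower bound for `P 1` is `exp (-‖f‖)`, and the distortion constant is `B(D)` with `D` a
  -- bound for `dI`, hence for the lattice metric.
  · obtain ⟨r, L, hL, hL1, hLP⟩ := LatticeMap.exists_positive_eigenfunctional
      (LatticeMap.averagedTransfer_nonneg _ _ f) (Real.exp_pos _)
      ((hV1 0 0).trans (hVC 0 0)) (LatticeMap.le_averagedTransfer_one _ _ f)
      (fun n x y => by
        have h := LatticeMap.pow_apply_one_mem_distortionCone hV1 hcone n
        exact (h.2 x y).trans (mul_le_mul_of_nonneg_right (hVC x y) (h.1 y))) 0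
    obtain ⟨ν, hν⟩ := LatticeMap.exists_probabilityMeasure_of_positive L hL hL1
    have hdual : ∀ Φ, LatticeMap.dualTransfer ζ p f ν Φ = r * L Φ := fun Φ => by
      simp only [LatticeMap.dualTransfer, htransfer]
      exact (hν _).trans (hLP Φ)
    exact ⟨ν, r, by rw [hdual, hL1, mul_one], fun Φ => by rw [hdual, hν]⟩
  · have hdual : ∀ Φ : C(LatticeMap.Lattice, ℝ), ∫ x, P Φ x ∂(ν : Measure LatticeMap.Lattice) =
        lam * ∫ x, Φ x ∂(ν : Measure LatticeMap.Lattice) := fun Φ => by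
      simpa only [LatticeMap.dualTransfer, htransfer] using hν.2 Φ
    -- `lam` is the integral of `P 1`, which is at least `exp (-‖f‖)`.
    have hlam : 0 < lam := by
      have h := integral_mono (μ := (ν : Measure LatticeMap.Lattice)) (integrable_const _)
        (LatticeMap.integrable_continuousMap _ (P 1))
        (LatticeMap.le_averagedTransfer_one _ (LatticeMap.latticeBranch hτ.continuous) f)
      rw [hdual] at h
      exact (Real.exp_pos (-‖f‖)).trans_le (by simpa using h)
    obtain ⟨h, hcone_h, hint, hPh⟩ := LatticeMap.exists_eigenfunction hVC hV1 hsymm hdiag hcone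
      hlam hdual
    have hpos := LatticeMap.pos_of_mem_distortionCone hcone_h hint
    refine ⟨h, ⟨hcone_h.1, hint, hcone_h.2⟩, fun x => by rw [htransfer, hPh]; rfl, hpos,
      fun h' hh' hPh' => ?_⟩
    refine LatticeMap.eigenfunction_unique (fun g hg hPg x₀ hx₀ => ?_) hpos hPh
      (ContinuousMap.ext fun x => (htransfer h' x).symm.trans (hPh' x)) hint hh'.2.1
    -- Irreducibility: the zero set of `g` is closed, nonempty and stable under all inverse
    -- branches, hence everything.
    have hZ := LatticeMap.dense_of_invariant hdI hη0 hη1 hτ hζ (Z := {x | g x = 0})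
      (isClosed_eq g.continuous continuous_const) ⟨x₀, hx₀⟩
      fun w x hx => LatticeMap.eq_zero_of_averagedTransfer_eq_smul _ _ f hg hPg hx w
    exact ContinuousMap.ext fun x => hZ.ge (Set.mem_univ x)
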